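/- A hypergroup is a locally compact Hausdorff space $K$ together with regular Borel probability measures $\delta_x*\delta_y$ $(x,y\in K)$ of compact support, an element $e\in K$ and a continuous map $x\mapsto\check x$ on $K$ with $\check{\check x}=x$, such that, writing $f(x*y)=\int_K f\,d(\delta_x*\delta_y)$ and $\langle\mu*\nu,f\rangle=\int_K\int_K f(x*y)\,d\mu(x)\,d\nu(y)$: - $(\delta_x*\delta_y)*\delta_z=\delta_x*(\delta_y*\delta_z)$ for all $x,y,z\in K$; - $(x,y)\mapsto\delta_x*\delta_y$ is continuous for the weak topology on probability measures, and $(x,y)\mapsto\operatorname{supp}(\delta_x*\delta_y)$ is continuous for the Michael (Vietoris) topology on the non-empty compact subsets of $K$; - $\delta_e*\delta_x=\delta_x*\delta_e=\delta_x$ for all $x\in K$; - the image of $\delta_x*\delta_y$ under $\check{\ }$ is $\delta_{\check y}*\delta_{\check x}$, and $e\in\operatorname{supp}(\delta_x*\delta_y)$ if and only if $x=\check y$. Let $K$ be a non-compact hypergroup with a left Haar measure $\omega$, that is, a non-zero positive Radon measure such that $\int_K f(x*y)\,d\omega(y)=\int_K f\,d\omega$ for all $x\in K$ and $f\in C_c(K)$;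 let $L^p(K)$ be the complex Lebesgue spaces of $\omega$. For $A,B\subseteq K$ put $A*B=\bigcup_{x\in A,\,y\in B}\operatorname{supp}(\delta_x*\delta_y)$, and let $A^n$ be the $n$-fold product of $A$. Let $\sigma$ be a regular Borel probability measure on $K$ that is non-degenerate, i.e. $K=\overline{\bigcup_{n\ge1}(\operatorname{supp}\sigma)^n}$. Put $$(\sigma*f)(x)=\int_K f(\check y*x)\,d\sigma(y),\qquad H^p_\sigma(K)=\{f\in L^p(K):\ \sigma*f=f\ \ \omega\text{-a.e.}\}.$$ Then $H^p_\sigma(K)=\{0\}$ for all $1<p<\infty$. -/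

import Mathlib

open MeasureTheory Set
open scoped ENNReal

/-- A hypergroup structure on a (locally compact Hausdorff) space `K` with its Borel `σ`-algebra.
The convolution of bounded Radon measures is given through the convolutions
`conv x y = δ_x * δ_y` of point masses, from which it is recovered by
`⟨μ * ν, f⟩ = ∫ ∫ ⟨δ_x * δ_y, f⟩ dμ(x) dν(y)`. -/
class Hypergroup (K : Type*) [TopologicalSpace K] [MeasurableSpace K] [BorelSpace K] where
  /-- `conv x y` is the probability measure `δ_x * δ_y`. -/
  conv : K → K → ProbabilityMeasure K
  /-- The identity element. -/
  e : K
  /-- The involution `x ↦ x̌`. -/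
  inv : K → K
  /-- `δ_x * δ_y` is a Radon measure. -/
  regular_conv : ∀ x y, (conv x y : Measure K).Regular
  /-- `δ_x * δ_y` has compact support. -/
  isCompact_support_conv : ∀ x y, IsCompact (conv x y : Measure K).support
  /-- `(δ_x * δ_y) * δ_z = δ_x * (δ_y * δ_z)`, tested against `C_c(K)`. -/
  conv_assoc : ∀ (x y z : K) (f : K → ℝ), Continuous f → HasCompactSupport f →
    ∫ t, (∫ s, f s ∂(conv t z : Measure K)) ∂(conv x y : Measure K) =
      ∫ t, (∫ s, f s ∂(conv x t : Measure K)) ∂(conv y z : Measure K)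
  /-- `(x, y) ↦ δ_x * δ_y` is continuous for the weak topology of probability measures. -/
  continuous_conv : Continuous fun q : K × K => conv q.1 q.2
  /-- `(x, y) ↦ supp (δ_x * δ_y)` is continuous for the Michael (Vietoris) topology. -/
  continuous_support_conv : @Continuous (K × K) (Set K) _ (TopologicalSpace.vietoris K)
    fun q => (conv q.1 q.2 : Measure K).support
  /-- `δ_e * δ_x = δ_x`. -/
  e_conv : ∀ x, (conv e x : Measure K) = Measure.dirac x
  /-- `δ_x * δ_e = δ_x`. -/
  conv_e : ∀ x, (conv x e : Measure K) = Measure.dirac x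
  continuous_inv : Continuous inv
  inv_inv : ∀ x, inv (inv x) = x
  /-- The image of `δ_x * δ_y` under the involution is `δ_y̌ * δ_x̌`. -/
  map_inv_conv : ∀ x y, (conv x y : Measure K).map inv = (conv (inv y) (inv x) : Measure K)
  /-- `e ∈ supp (δ_x * δ_y)` if and only if `x = y̌`. -/
  e_mem_support_conv_iff : ∀ x y, e ∈ (conv x y : Measure K).support ↔ x = inv y

namespace Hypergroup

variable {K : Type*} [TopologicalSpace K] [MeasurableSpace K] [BorelSpace K] [Hypergroup K]

/-- `f(x * y) = ∫ f d(δ_x * δ_y)`. -/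
noncomputable def translate {E : Type*} [NormedAddCommGroup E] [NormedSpace ℝ E]
    (f : K → E) (x y : K) : E :=
  ∫ t, f t ∂(conv x y : Measure K)

/-- A left Haar measure: a non-zero Radon measure `ω` with `δ_x * ω = ω` for all `x`, that is,
`∫ f(x * y) dω(y) = ∫ f dω` for all `f ∈ C_c(K)`. -/
structure IsLeftHaar (ω : Measure K) : Prop where
  regular : ω.Regular
  ne_zero : ω ≠ 0
  left_invariant : ∀ (x : K) (f : K → ℝ), Continuous f → HasCompactSupport f →
    ∫ y, translate f x y ∂ω = ∫ y, f y ∂ω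

/-- `(σ * f)(x) = ∫ f(y̌ * x) dσ(y)`. -/
noncomputable def measureConv (σ : Measure K) (f : K → ℂ) (x : K) : ℂ :=
  ∫ y, translate f (inv y) x ∂σ

/-- `H_σ^p(K)`, the set of all `f ∈ L^p(K, ω)` with `σ * f = f` (as elements of `L^p`). -/
def harmonicLp (σ ω : Measure K) (p : ℝ≥0∞) : Set (Lp ℂ p ω) :=
  {f | measureConv σ f =ᵐ[ω] f}

/-- The product of two subsets, `A * B = ⋃ supp (δ_x * δ_y)` over `x ∈ A`, `y ∈ B`. -/
def setMul (A B : Set K) : Set K :=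
  ⋃ x ∈ A, ⋃ y ∈ B, (conv x y : Measure K).support

/-- The powers of a subset. -/
def setPow (A : Set K) : ℕ → Set K
  | 0 => {e}
  | n + 1 => setMul (setPow A n) A

/-- A (positive) measure `σ` is non-degenerate if `⋃ (supp σ)^n`, over `n ≥ 1`, is dense in `K`. -/
def NonDegenerate (σ : Measure K) : Prop :=
  closure (⋃ n ≥ 1, setPow σ.support n) = univ

end Hypergroup

/-!
Let `f ∈ L^p` with `σ * f = f`, `1 < p < ∞`. Write `P_x = σ̌ * δ_x` (`leftConv σ x`), so that
`(σ * f)(x) = ∫ f dP_x`. Left invariance of `ω` gives that the integral `∫ P_x dω(x)` is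
at most `ω` (`IsLeftHaar.bind_leftConv_le`). Hence
`∫ |f|^p dω ≤ ∫ (∫ |f|^p dP_x) dω(x) ≤ ∫ |f|^p dω`, and equality in Jensen's inequality forces
`|f| = |f x|` to hold `P_x`-almost everywhere, for almost every `x`
(`ae_ae_norm_eq_of_measureConv_ae_eq`). So each level set `A = {|f| > r}`, `r > 0`, which has finite
measure, loses no mass: `P_x(Aᶜ) = 0` for almost every `x ∈ A`.

For such an `A` let `S` be the set of all `y` with `(δ_y̌ * δ_x)(Aᶜ) = 0` for almost every `x ∈ A`
(`invariantSet`). The function `y ↦ ∫_A (δ_y̌ * δ_x)(Aᶜ) dω(x)` is lower semicontinuous, so `S` is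
closed; by Tonelli it contains the support of `σ`, and by associativity it is stable under the
product of the hypergroup (`support_conv_subset_invariantSet`). Non-degeneracy gives `S = K`. But
`A` is compact up to a small error, and in a non-compact hypergroup some `y̌` moves a given compact
set off itself, so `ω A = 0` (`measure_eq_zero_of_invariantSet_eq_univ`). As `r` is arbitrary,
`f = 0`.

No countability assumption is made on `K`, so Borel sets of `K × K` need not be measurable for the
product `σ`-algebra, and `ω` need not be `σ`-finite. All interchanges of integrals are therefore
made for lower semicontinuous functions, where regularity of the measures gives compatibility with
arbitrary directed suprema (`lintegral_iSup_of_directed_of_lowerSemicontinuous`) and Tonelli's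
theorem (`lintegral_lintegral_swap_of_lowerSemicontinuous`); Borel sets are reached by outer
regularity.
-/

open Topology Filter
open scoped NNReal

/-! ### Regular measures and lower semicontinuous functions -/

section Semicontinuity

variable {X Y : Type*} [TopologicalSpace X] [TopologicalSpace Y]

lemma measure_iUnion_of_directed_of_isOpen [MeasurableSpace X]
    {ι : Type*} [Nonempty ι] (μ : Measure X) [μ.Regular] {U : ι → Set X}
    (hU : ∀ i, IsOpen (U i)) (hd : Directed (· ⊆ ·) U) :
    μ (⋃ i, U i) = ⨆ i, μ (U i) := by
  refine le_antisymm ?_ (iSup_le fun i => measure_mono (subset_iUnion U i))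
  rw [(isOpen_iUnion hU).measure_eq_iSup_isCompact μ]
  refine iSup₂_le fun C hC => iSup_le fun hCc => ?_
  obtain ⟨i, hi⟩ := hCc.elim_directed_cover U hU hC hd
  exact (measure_mono hi).trans (le_iSup (fun i => μ (U i)) i)

/-- **τ-smoothness**: a regular measure commutes with directed suprema, of arbitrary cardinality,
of lower semicontinuous functions. A countable subfamily already has the same
superlevel sets up to null sets. -/
theorem lintegral_iSup_of_directed_of_lowerSemicontinuous [MeasurableSpace X] [BorelSpace X]
    {ι : Type*} [Nonempty ι] (μ : Measure X) [μ.Regular] {g : ι → X → ℝ≥0∞}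
    (hg : ∀ i, LowerSemicontinuous (g i))
    (hd : Directed (· ≤ ·) g) :
    ∫⁻ x, ⨆ i, g i x ∂μ = ⨆ i, ∫⁻ x, g i x ∂μ := by
  refine le_antisymm ?_ (iSup_le fun i => lintegral_mono fun x => le_iSup (fun i => g i x) i)
  -- on superlevel sets, which are open, inner regularity by compact sets suffices
  have hlevel : ∀ c : ℝ≥0∞, μ {x | c < ⨆ i, g i x} = ⨆ i, μ {x | c < g i x} := by
    intro c
    have : {x | c < ⨆ i, g i x} = ⋃ i, {x | c < g i x} := by
      ext x; simp [lt_iSup_iff]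
    rw [this]
    refine measure_iUnion_of_directed_of_isOpen μ (fun i => (hg i).isOpen_preimage c) ?_
    intro i j
    obtain ⟨k, hik, hjk⟩ := hd i j
    exact ⟨k, fun x hx => lt_of_lt_of_le hx (hik x), fun x hx => lt_of_lt_of_le hx (hjk x)⟩
  have hseq : ∀ q : ℚ, ∃ u : ℕ → ι, ⨆ i, μ {x | (Real.toNNReal q : ℝ≥0∞) < g i x} =
      ⨆ n, μ {x | (Real.toNNReal q : ℝ≥0∞) < g (u n) x} := by
    intro q
    obtain ⟨w, -, hw, hwr⟩ := exists_seq_tendsto_sSup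
      (range_nonempty fun i => μ {x | (Real.toNNReal q : ℝ≥0∞) < g i x}) (OrderTop.bddAbove _)
    choose u hu using hwr
    refine ⟨u, le_antisymm ?_ (iSup_le fun n => le_iSup
      (fun i => μ {x | (Real.toNNReal q : ℝ≥0∞) < g i x}) (u n))⟩
    refine le_of_tendsto' hw fun n => ?_
    rw [← hu n]
    exact le_iSup (fun n => μ {x | (Real.toNNReal q : ℝ≥0∞) < g (u n) x}) n
  choose u hu using hseq
  -- countably many indices exhaust all rational superlevel sets up to null sets; directedness
  -- makes an increasing sequence out of them
  obtain ⟨enum, henum⟩ := exists_surjective_nat (ℚ × ℕ)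
  choose d hd₁ hd₂ using hd
  let j : ℕ → ι := fun n => Nat.rec (u 0 0) (fun n i => d i (u (enum n).1 (enum n).2)) n
  have hjmono : Monotone fun n => g (j n) := monotone_nat_of_le_succ fun n => hd₁ _ _
  have hju : ∀ q n, ∃ m, g (u q n) ≤ g (j m) := by
    intro q n
    obtain ⟨m, hm⟩ := henum (q, n)
    refine ⟨m + 1, ?_⟩
    have := hd₂ (j m) (u (enum m).1 (enum m).2)
    rw [hm] at this
    simpa [j, hm] using this
  set g' : X → ℝ≥0∞ := fun x => ⨆ n, g (j n) x with hg'
  have hg'm : Measurable g' := Measurable.iSup fun n => (hg _).measurable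
  have hint : ∫⁻ x, g' x ∂μ ≤ ⨆ i, ∫⁻ x, g i x ∂μ := by
    rw [lintegral_iSup (fun n => (hg _).measurable) hjmono]
    exact iSup_le fun n => le_iSup (fun i => ∫⁻ x, g i x ∂μ) (j n)
  refine le_trans ?_ hint
  have hle : ∀ q : ℚ, μ {x | (Real.toNNReal q : ℝ≥0∞) < ⨆ i, g i x} ≤
      μ {x | (Real.toNNReal q : ℝ≥0∞) < g' x} := by
    intro q
    rw [hlevel, hu q]
    refine iSup_le fun n => ?_
    obtain ⟨m, hm⟩ := hju q n
    exact measure_mono fun x hx => lt_of_lt_of_le hx ((hm x).trans (le_iSup (fun n => g (j n) x) m))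
  have hsub : ∀ x, g' x ≤ ⨆ i, g i x := fun x => iSup_le fun n => le_iSup (fun i => g i x) (j n)
  by_cases hinf : ∃ q : ℚ, 0 < q ∧ μ {x | (Real.toNNReal q : ℝ≥0∞) < ⨆ i, g i x} = ∞
  · obtain ⟨q, hq, hμ⟩ := hinf
    have h1 := mul_meas_ge_le_lintegral (μ := μ) hg'm (Real.toNNReal q : ℝ≥0∞)
    have h2 : μ {x | (Real.toNNReal q : ℝ≥0∞) ≤ g' x} = ∞ := by
      refine top_le_iff.1 (hμ ▸ (hle q).trans (measure_mono fun x hx => ?_))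
      exact le_of_lt (show _ < g' x from hx)
    rw [h2, ENNReal.mul_top (by simpa using hq)] at h1
    exact le_top.trans h1
  · push Not at hinf
    refine lintegral_mono_ae ?_
    have hnull : ∀ q : ℚ, 0 < q → μ ({x | (Real.toNNReal q : ℝ≥0∞) < ⨆ i, g i x} \
        {x | (Real.toNNReal q : ℝ≥0∞) < g' x}) = 0 := by
      intro q hq
      have hs : {x | (Real.toNNReal q : ℝ≥0∞) < g' x} ⊆
          {x | (Real.toNNReal q : ℝ≥0∞) < ⨆ i, g i x} := fun x hx => lt_of_lt_of_le hx (hsub x)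
      have hm : MeasurableSet {x | (Real.toNNReal q : ℝ≥0∞) < g' x} :=
        measurableSet_lt measurable_const hg'm
      rw [measure_sdiff hs hm.nullMeasurableSet (ne_top_of_le_ne_top (hinf q hq) (measure_mono hs)),
        tsub_eq_zero_iff_le]
      exact hle q
    have hall : ∀ᵐ x ∂μ, ∀ q : ℚ, 0 < q → x ∉ ({x | (Real.toNNReal q : ℝ≥0∞) < ⨆ i, g i x} \
        {x | (Real.toNNReal q : ℝ≥0∞) < g' x}) := by
      rw [ae_all_iff]
      intro q
      by_cases hq : 0 < q
      · filter_upwards [measure_eq_zero_iff_ae_notMem.1 (hnull q hq)] with x hx _ using hx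
      · exact Eventually.of_forall fun x h => absurd h hq
    filter_upwards [hall] with x hx
    by_contra! hlt
    obtain ⟨q, hq0, h1, h2⟩ := ENNReal.lt_iff_exists_rat_btwn.1 hlt
    have hq : 0 < q := by
      have : 0 < Real.toNNReal q := by
        exact_mod_cast lt_of_le_of_lt (zero_le (a := g' x)) h1
      simpa using this
    exact hx q hq ⟨h2, not_lt.2 h1.le⟩

/-- The continuous compactly supported functions below `F`. -/
def ccMinorants (F : X → ℝ≥0∞) : Set (X → ℝ≥0) :=
  {g | Continuous g ∧ HasCompactSupport g ∧ ∀ x, (g x : ℝ≥0∞) ≤ F x}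

lemma zero_mem_ccMinorants (F : X → ℝ≥0∞) : (0 : X → ℝ≥0) ∈ ccMinorants F :=
  ⟨continuous_zero, HasCompactSupport.zero, by simp⟩

lemma sup_mem_ccMinorants {F : X → ℝ≥0∞} {g h : X → ℝ≥0} (hg : g ∈ ccMinorants F)
    (hh : h ∈ ccMinorants F) : g ⊔ h ∈ ccMinorants F := by
  refine ⟨hg.1.sup hh.1, ?_, fun x => ?_⟩
  · refine (hg.2.1.isCompact.union hh.2.1.isCompact).of_isClosed_subset (isClosed_tsupport _) ?_
    refine closure_minimal (fun x hx => ?_)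
      ((isClosed_tsupport _).union (isClosed_tsupport _))
    by_contra hx'
    simp only [mem_union, not_or] at hx'
    exact hx (by simp [image_eq_zero_of_notMem_tsupport hx'.1,
      image_eq_zero_of_notMem_tsupport hx'.2])
  · rcases le_total (g x) (h x) with hle | hle
    · simpa [hle] using hh.2.2 x
    · simpa [hle] using hg.2.2 x
 
instance (F : X → ℝ≥0∞) : Nonempty (ccMinorants F) := ⟨⟨0, zero_mem_ccMinorants F⟩⟩

lemma directed_ccMinorants (F : X → ℝ≥0∞) :
    Directed (· ≤ ·) fun (g : ccMinorants F) (x : X) => ((g : X → ℝ≥0) x : ℝ≥0∞) := by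
  intro g h
  refine ⟨⟨_, sup_mem_ccMinorants g.2 h.2⟩, fun x => ?_, fun x => ?_⟩
  · exact ENNReal.coe_le_coe.2 le_sup_left
  · exact ENNReal.coe_le_coe.2 le_sup_right

lemma directed_map_ccMinorants (F : X → ℝ≥0∞) {Z : Type*} {T : (X → ℝ≥0∞) → Z → ℝ≥0∞}
    (hT : Monotone T) :
    Directed (· ≤ ·) fun (g : ccMinorants F) => T fun x => ((g : X → ℝ≥0) x : ℝ≥0∞) := by
  intro g h
  obtain ⟨k, hg, hh⟩ := directed_ccMinorants F g h
  exact ⟨k, hT hg, hT hh⟩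

/-- On a locally compact Hausdorff space, Urysohn's lemma makes a lower semicontinuous function the
supremum of its minorants in `C_c`. -/
lemma iSup_ccMinorants [T2Space X] [LocallyCompactSpace X] {F : X → ℝ≥0∞}
    (hF : LowerSemicontinuous F) (x : X) :
    ⨆ g : ccMinorants F, ((g : X → ℝ≥0) x : ℝ≥0∞) = F x := by
  refine le_antisymm (iSup_le fun g => g.2.2.2 x) ?_
  refine le_of_forall_lt fun c hc => ?_
  obtain ⟨r, hcr, hr⟩ := ENNReal.lt_iff_exists_nnreal_btwn.1 hc
  obtain ⟨f, hf1, hf0, hfc, hf⟩ := exists_continuous_one_zero_of_isCompact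
    (isCompact_singleton (x := x))
    (hF.isOpen_preimage r).isClosed_compl (by simpa using hr)
  have hmem : (fun z => r * Real.toNNReal (f z)) ∈ ccMinorants F := by
    refine ⟨by fun_prop, ?_, fun z => ?_⟩
    · refine hfc.mono fun z hz => ?_
      rw [Function.mem_support] at hz ⊢
      rintro h0
      simp [h0] at hz
    · by_cases hz : z ∈ F ⁻¹' Ioi (r : ℝ≥0∞)
      · refine le_trans ?_ (le_of_lt hz)
        rw [ENNReal.coe_le_coe]
        exact mul_le_of_le_one_right zero_le (by simpa using (hf z).2)
      · have : f z = 0 := hf0 hz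
        simp [this]
  refine lt_of_lt_of_le hcr ?_
  refine le_trans ?_ (le_iSup (fun g : ccMinorants F => ((g : X → ℝ≥0) x : ℝ≥0∞)) ⟨_, hmem⟩)
  have : f x = 1 := hf1 rfl
  simp [this]

lemma lintegral_eq_iSup_ccMinorants [MeasurableSpace X] [BorelSpace X] [T2Space X]
    [LocallyCompactSpace X] (μ : Measure X) [μ.Regular] {F : X → ℝ≥0∞}
    (hF : LowerSemicontinuous F) :
    ∫⁻ x, F x ∂μ = ⨆ g : ccMinorants F, ∫⁻ x, ((g : X → ℝ≥0) x : ℝ≥0∞) ∂μ := by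
  rw [← lintegral_iSup_of_directed_of_lowerSemicontinuous μ
    (g := fun (g : ccMinorants F) x => ((g : X → ℝ≥0) x : ℝ≥0∞))
    (fun g => (ENNReal.continuous_coe.comp g.2.1).lowerSemicontinuous) (directed_ccMinorants F)]
  simp only [iSup_ccMinorants hF]

lemma lintegral_coe_eq_ofReal_integral [MeasurableSpace X] [BorelSpace X]
    {μ : Measure X} [IsFiniteMeasureOnCompacts μ]
    {g : X → ℝ≥0} (hg : Continuous g) (hgc : HasCompactSupport g) :
    ∫⁻ x, (g x : ℝ≥0∞) ∂μ = ENNReal.ofReal (∫ x, (g x : ℝ) ∂μ) :=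
  lintegral_coe_eq_integral g ((NNReal.continuous_coe.comp hg).integrable_of_hasCompactSupport
    (hgc.comp_left (g := ((↑) : ℝ≥0 → ℝ)) rfl))

lemma HasCompactSupport.comp_prodMk_left {E : Type*} [Zero E] [T2Space Y] {g : X × Y → E}
    (hgc : HasCompactSupport g) (x : X) : HasCompactSupport fun y => g (x, y) := by
  refine HasCompactSupport.intro (hgc.isCompact.image continuous_snd) fun y hy => ?_
  exact image_eq_zero_of_notMem_tsupport fun h => hy ⟨_, h, rfl⟩

lemma HasCompactSupport.comp_prodMk_right {E : Type*} [Zero E] [T2Space X] {g : X × Y → E}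
    (hgc : HasCompactSupport g) (y : Y) : HasCompactSupport fun x => g (x, y) := by
  refine HasCompactSupport.intro (hgc.isCompact.image continuous_fst) fun x hx => ?_
  exact image_eq_zero_of_notMem_tsupport fun h => hx ⟨_, h, rfl⟩

lemma continuous_integral_of_hasCompactSupport_prod [MeasurableSpace Y] [BorelSpace Y]
    (ν : Measure Y) [IsFiniteMeasureOnCompacts ν]
    {g : X × Y → ℝ≥0} (hg : Continuous g) (hgc : HasCompactSupport g) :
    Continuous fun x => ∫ y, (g (x, y) : ℝ) ∂ν := by
  rw [← continuousOn_univ]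
  refine continuousOn_integral_of_compact_support (hgc.isCompact.image continuous_snd)
    (f := fun x y => (g (x, y) : ℝ)) ?_ fun x y _ hy => ?_
  · exact (NNReal.continuous_coe.comp hg).continuousOn
  · have : g (x, y) = 0 := image_eq_zero_of_notMem_tsupport fun h => hy ⟨_, h, rfl⟩
    simp [this]

lemma continuous_lintegral_of_hasCompactSupport_prod [MeasurableSpace Y] [BorelSpace Y]
    [T2Space Y] (ν : Measure Y) [IsFiniteMeasureOnCompacts ν]
    {g : X × Y → ℝ≥0} (hg : Continuous g) (hgc : HasCompactSupport g) :
    Continuous fun x => ∫⁻ y, (g (x, y) : ℝ≥0∞) ∂ν := by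
  have : ∀ x, ∫⁻ y, (g (x, y) : ℝ≥0∞) ∂ν = ENNReal.ofReal (∫ y, (g (x, y) : ℝ) ∂ν) := fun x =>
    lintegral_coe_eq_ofReal_integral (g := fun y => g (x, y)) (by fun_prop)
      (hgc.comp_prodMk_left x)
  simp only [this]
  exact ENNReal.continuous_ofReal.comp (continuous_integral_of_hasCompactSupport_prod ν hg hgc)

lemma lintegral_lintegral_swap_of_hasCompactSupport [MeasurableSpace X] [BorelSpace X]
    [MeasurableSpace Y] [BorelSpace Y] [T2Space X] [T2Space Y]
    (μ : Measure X) (ν : Measure Y) [IsFiniteMeasureOnCompacts μ] [IsFiniteMeasureOnCompacts ν]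
    {g : X × Y → ℝ≥0} (hg : Continuous g) (hgc : HasCompactSupport g) :
    ∫⁻ x, ∫⁻ y, (g (x, y) : ℝ≥0∞) ∂ν ∂μ = ∫⁻ y, ∫⁻ x, (g (x, y) : ℝ≥0∞) ∂μ ∂ν := by
  have hswapc : HasCompactSupport fun q : Y × X => g (q.2, q.1) :=
    hgc.comp_homeomorph (Homeomorph.prodComm Y X)
  have h1 : ∀ x, ∫⁻ y, (g (x, y) : ℝ≥0∞) ∂ν = ENNReal.ofReal (∫ y, (g (x, y) : ℝ) ∂ν) := fun x =>
    lintegral_coe_eq_ofReal_integral (g := fun y => g (x, y)) (by fun_prop)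
      (hgc.comp_prodMk_left x)
  have h2 : ∀ y, ∫⁻ x, (g (x, y) : ℝ≥0∞) ∂μ = ENNReal.ofReal (∫ x, (g (x, y) : ℝ) ∂μ) := fun y =>
    lintegral_coe_eq_ofReal_integral (g := fun x => g (x, y)) (by fun_prop)
      (hgc.comp_prodMk_right y)
  simp only [h1, h2]
  have c1 : HasCompactSupport fun x => ∫ y, (g (x, y) : ℝ) ∂ν := by
    refine HasCompactSupport.intro (hgc.isCompact.image continuous_fst) fun x hx => ?_
    have : ∀ y, g (x, y) = 0 := fun y =>
      image_eq_zero_of_notMem_tsupport fun h => hx ⟨_, h, rfl⟩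
    simp [this]
  have c2 : HasCompactSupport fun y => ∫ x, (g (x, y) : ℝ) ∂μ := by
    refine HasCompactSupport.intro (hgc.isCompact.image continuous_snd) fun y hy => ?_
    have : ∀ x, g (x, y) = 0 := fun x =>
      image_eq_zero_of_notMem_tsupport fun h => hy ⟨_, h, rfl⟩
    simp [this]
  rw [← ofReal_integral_eq_lintegral_ofReal, ← ofReal_integral_eq_lintegral_ofReal]
  · congr 1
    exact integral_integral_swap_of_hasCompactSupport (f := fun x y => (g (x, y) : ℝ))
      (NNReal.continuous_coe.comp hg) (hgc.comp_left (g := ((↑) : ℝ≥0 → ℝ)) rfl)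
  · exact (continuous_integral_of_hasCompactSupport_prod (g := fun q : Y × X => g (q.2, q.1)) μ
      (by fun_prop) hswapc).integrable_of_hasCompactSupport c2
  · exact Eventually.of_forall fun y => integral_nonneg fun x => NNReal.coe_nonneg _
  · exact (continuous_integral_of_hasCompactSupport_prod ν hg
      hgc).integrable_of_hasCompactSupport c1
  · exact Eventually.of_forall fun x => integral_nonneg fun y => NNReal.coe_nonneg _

lemma lintegral_prodMk_eq_iSup_ccMinorants [MeasurableSpace Y] [BorelSpace Y]
    [T2Space X] [LocallyCompactSpace X] [T2Space Y]
    [LocallyCompactSpace Y] (ν : Measure Y) [ν.Regular] {F : X × Y → ℝ≥0∞}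
    (hF : LowerSemicontinuous F) (x : X) :
    ∫⁻ y, F (x, y) ∂ν = ⨆ g : ccMinorants F, ∫⁻ y, ((g : X × Y → ℝ≥0) (x, y) : ℝ≥0∞) ∂ν := by
  have hlsc (g : ccMinorants F) :
      LowerSemicontinuous fun y => ((g : X × Y → ℝ≥0) (x, y) : ℝ≥0∞) :=
    (ENNReal.continuous_coe.comp (g.2.1.comp (Continuous.prodMk_right x))).lowerSemicontinuous
  rw [← lintegral_iSup_of_directed_of_lowerSemicontinuous ν hlsc
    (directed_map_ccMinorants F (T := fun h y => h (x, y)) fun g h hgh y => hgh (x, y))]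
  simp only [iSup_ccMinorants hF]

lemma lowerSemicontinuous_lintegral_prodMk [MeasurableSpace Y] [BorelSpace Y]
    [T2Space X] [LocallyCompactSpace X] [T2Space Y]
    [LocallyCompactSpace Y] (ν : Measure Y) [ν.Regular] {F : X × Y → ℝ≥0∞}
    (hF : LowerSemicontinuous F) : LowerSemicontinuous fun x => ∫⁻ y, F (x, y) ∂ν := by
  simp only [lintegral_prodMk_eq_iSup_ccMinorants ν hF]
  exact lowerSemicontinuous_iSup fun g =>
    (continuous_lintegral_of_hasCompactSupport_prod ν g.2.1 g.2.2.1).lowerSemicontinuous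

/-- **Tonelli's theorem** for lower semicontinuous functions and regular measures. Neither
`σ`-finiteness nor measurability for the product `σ`-algebra is needed. -/
theorem lintegral_lintegral_swap_of_lowerSemicontinuous
    [MeasurableSpace X] [BorelSpace X] [MeasurableSpace Y] [BorelSpace Y]
    [T2Space X] [LocallyCompactSpace X]
    [T2Space Y] [LocallyCompactSpace Y] (μ : Measure X) (ν : Measure Y) [μ.Regular] [ν.Regular]
    {F : X × Y → ℝ≥0∞} (hF : LowerSemicontinuous F) :
    ∫⁻ x, ∫⁻ y, F (x, y) ∂ν ∂μ = ∫⁻ y, ∫⁻ x, F (x, y) ∂μ ∂ν := by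
  have hc : ∀ g : ccMinorants F, HasCompactSupport fun q : Y × X => (g : X × Y → ℝ≥0) (q.2, q.1) :=
    fun g => g.2.2.1.comp_homeomorph (Homeomorph.prodComm Y X)
  have h2 : ∀ y, ∫⁻ x, F (x, y) ∂μ =
      ⨆ g : ccMinorants F, ∫⁻ x, ((g : X × Y → ℝ≥0) (x, y) : ℝ≥0∞) ∂μ := by
    intro y
    have hlsc (g : ccMinorants F) :
        LowerSemicontinuous fun x => ((g : X × Y → ℝ≥0) (x, y) : ℝ≥0∞) :=
      (ENNReal.continuous_coe.comp (g.2.1.comp (Continuous.prodMk_left y))).lowerSemicontinuous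
    rw [← lintegral_iSup_of_directed_of_lowerSemicontinuous μ hlsc
      (directed_map_ccMinorants F (T := fun h x => h (x, y)) fun g h hgh x => hgh (x, y))]
    simp only [iSup_ccMinorants hF]
  simp only [lintegral_prodMk_eq_iSup_ccMinorants ν hF, h2]
  rw [lintegral_iSup_of_directed_of_lowerSemicontinuous μ,
    lintegral_iSup_of_directed_of_lowerSemicontinuous ν]
  · congr 1 with g
    exact lintegral_lintegral_swap_of_hasCompactSupport μ ν g.2.1 g.2.2.1
  · exact fun g => (continuous_lintegral_of_hasCompactSupport_prod
      (g := fun q : Y × X => (g : X × Y → ℝ≥0) (q.2, q.1)) μ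
      (g.2.1.comp continuous_swap) (hc g)).lowerSemicontinuous
  · exact directed_map_ccMinorants F (T := fun h y => ∫⁻ x, h (x, y) ∂μ)
      (fun g h hgh y => lintegral_mono fun x => hgh (x, y))
  · exact fun g => (continuous_lintegral_of_hasCompactSupport_prod ν g.2.1
      g.2.2.1).lowerSemicontinuous
  · exact directed_map_ccMinorants F (T := fun h x => ∫⁻ y, h (x, y) ∂ν)
      (fun g h hgh x => lintegral_mono fun y => hgh (x, y))

end Semicontinuity

/-- By outer regularity, domination on open sets extends to Borel sets. -/
lemma bind_le_of_forall_isOpen {X : Type*} [TopologicalSpace X] [MeasurableSpace X] [BorelSpace X]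
    {ω : Measure X} [ω.OuterRegular] {P : X → Measure X}
    (hP : Measurable P) (h : ∀ U, IsOpen U → ∫⁻ x, P x U ∂ω ≤ ω U) : ω.bind P ≤ ω := by
  refine Measure.le_iff.2 fun B hB => ?_
  rw [B.measure_eq_iInf_isOpen ω]
  refine le_iInf₂ fun U hBU => le_iInf fun hU => (measure_mono hBU).trans ?_
  rw [Measure.bind_apply hU.measurableSet hP.aemeasurable]
  exact h U hU

/-- Let `P` be a Markov kernel that does not increase `ω`. The mass moved from `U` to the complement
of `C` exceeds the mass moved from `A` to its complement by at most `ω (A \ C) + ω (U \ A)`. -/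
lemma lintegral_restrict_compl_le {X : Type*} [MeasurableSpace X] {ω : Measure X}
    {P : X → Measure X}
    [∀ x, IsProbabilityMeasure (P x)] (hP : Measurable P) (hω : ω.bind P ≤ ω) {C A U : Set X}
    (hC : MeasurableSet C) (hA : MeasurableSet A)
    (hAU : A ⊆ U) :
    ∫⁻ x in U, P x Cᶜ ∂ω ≤ ∫⁻ x in A, P x Aᶜ ∂ω + ω (A \ C) + ω (U \ A) := by
  have h1 : ∫⁻ x in U, P x Cᶜ ∂ω ≤ ∫⁻ x in A, P x Cᶜ ∂ω + ω (U \ A) := by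
    calc ∫⁻ x in U, P x Cᶜ ∂ω = ∫⁻ x in A ∪ U \ A, P x Cᶜ ∂ω := by rw [union_sdiff_cancel hAU]
      _ ≤ ∫⁻ x in A, P x Cᶜ ∂ω + ∫⁻ x in U \ A, P x Cᶜ ∂ω := lintegral_union_le _ _ _
      _ ≤ ∫⁻ x in A, P x Cᶜ ∂ω + ∫⁻ x in U \ A, 1 ∂ω := by
        gcongr; exact prob_le_one
      _ = _ := by simp
  have h2 : ∫⁻ x in A, P x Cᶜ ∂ω ≤ ∫⁻ x in A, P x Aᶜ ∂ω + ω (A \ C) := by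
    calc ∫⁻ x in A, P x Cᶜ ∂ω ≤ ∫⁻ x in A, (P x Aᶜ + P x (A \ C)) ∂ω := by
          refine lintegral_mono fun x => (measure_mono ?_).trans (measure_union_le _ _)
          intro z hz
          by_cases hzA : z ∈ A
          · exact Or.inr ⟨hzA, hz⟩
          · exact Or.inl hzA
      _ = ∫⁻ x in A, P x Aᶜ ∂ω + ∫⁻ x in A, P x (A \ C) ∂ω :=
        lintegral_add_left ((Measure.measurable_coe hA.compl).comp hP) _
      _ ≤ ∫⁻ x in A, P x Aᶜ ∂ω + ω (A \ C) := by
        gcongr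
        refine (setLIntegral_le_lintegral _ _).trans ?_
        rw [← Measure.bind_apply (hA.diff hC) hP.aemeasurable]
        exact hω _
  calc _ ≤ _ := h1
    _ ≤ _ := by gcongr

lemma exists_isCompact_isOpen_sdiff_lt {X : Type*} [TopologicalSpace X] [MeasurableSpace X]
    [BorelSpace X] [T2Space X] {ω : Measure X} [ω.Regular] {A : Set X}
    (hA : MeasurableSet A) (hωA : ω A ≠ ∞) {ε : ℝ≥0∞} (hε : ε ≠ 0) :
    ∃ C U, C ⊆ A ∧ A ⊆ U ∧ IsCompact C ∧ IsOpen U ∧ ω (A \ C) + ω (U \ A) < ε := by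
  have hε2 : ε / 2 ≠ 0 := (ENNReal.half_pos hε).ne'
  obtain ⟨C, hCA, hC, hC'⟩ := hA.exists_isCompact_sdiff_lt hωA hε2
  obtain ⟨U, hAU, hU, -, hU'⟩ := hA.exists_isOpen_sdiff_lt hωA hε2
  refine ⟨C, U, hCA, hAU, hC, hU, ?_⟩
  calc _ < ε / 2 + ε / 2 := ENNReal.add_lt_add hC' hU'
    _ = ε := ENNReal.add_halves ε

/-! ### Convolution of points -/

namespace Hypergroup

variable {K : Type*} [TopologicalSpace K] [MeasurableSpace K] [BorelSpace K] [Hypergroup K]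

instance (x y : K) : (conv x y : Measure K).Regular := regular_conv x y

lemma lintegral_conv_conv_of_hasCompactSupport (x y z : K) {g : K → ℝ≥0} (hg : Continuous g)
    (hgc : HasCompactSupport g) :
    ∫⁻ t, ∫⁻ s, g s ∂(conv t z : Measure K) ∂(conv x y : Measure K) =
      ∫⁻ t, ∫⁻ s, g s ∂(conv x t : Measure K) ∂(conv y z : Measure K) := by
  have hR : Continuous fun s => (g s : ℝ) := NNReal.continuous_coe.comp hg
  have hRc : HasCompactSupport fun s => (g s : ℝ) := hgc.comp_left (g := ((↑) : ℝ≥0 → ℝ)) rfl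
  obtain ⟨C, hC⟩ := hRc.exists_bound_of_continuous hR
  let b : BoundedContinuousFunction K ℝ := BoundedContinuousFunction.ofNormedAddCommGroup _ hR C hC
  have hcont : Continuous fun q : K × K => ∫ s, (g s : ℝ) ∂(conv q.1 q.2 : Measure K) :=
    (ProbabilityMeasure.continuous_integral_boundedContinuousFunction b).comp continuous_conv
  have hbd : ∀ q : K × K, ‖∫ s, (g s : ℝ) ∂(conv q.1 q.2 : Measure K)‖ ≤ C := by
    intro q
    simpa using norm_integral_le_of_norm_le_const (μ := (conv q.1 q.2 : Measure K))
      (Eventually.of_forall hC)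
  have key : ∀ (μ : ProbabilityMeasure K) (u : K → K × K), Continuous u →
      ∫⁻ t, ∫⁻ s, g s ∂(conv (u t).1 (u t).2 : Measure K) ∂(μ : Measure K) =
        ENNReal.ofReal (∫ t, ∫ s, (g s : ℝ) ∂(conv (u t).1 (u t).2 : Measure K)
          ∂(μ : Measure K)) := by
    intro μ u hu
    rw [ofReal_integral_eq_lintegral_ofReal]
    · simp only [lintegral_coe_eq_ofReal_integral hg hgc]
    · exact Integrable.of_bound (hcont.comp hu).aestronglyMeasurable C
        (Eventually.of_forall fun t => hbd (u t))
    · exact Eventually.of_forall fun t => integral_nonneg fun s => NNReal.coe_nonneg _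
  rw [key (conv x y) (fun t => (t, z)) (by fun_prop),
    key (conv y z) (fun t => (x, t)) (by fun_prop),
    conv_assoc x y z _ hR hRc]

lemma continuous_lintegral_conv {g : K → ℝ≥0} (hg : Continuous g) (hgc : HasCompactSupport g) :
    Continuous fun q : K × K => ∫⁻ s, (g s : ℝ≥0∞) ∂(conv q.1 q.2 : Measure K) := by
  have hR : Continuous fun s => (g s : ℝ) := NNReal.continuous_coe.comp hg
  have hRc : HasCompactSupport fun s => (g s : ℝ) := hgc.comp_left (g := ((↑) : ℝ≥0 → ℝ)) rfl
  obtain ⟨C, hC⟩ := hRc.exists_bound_of_continuous hR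
  let b : BoundedContinuousFunction K ℝ := BoundedContinuousFunction.ofNormedAddCommGroup _ hR C hC
  simp only [lintegral_coe_eq_ofReal_integral hg hgc]
  exact ENNReal.continuous_ofReal.comp
    ((ProbabilityMeasure.continuous_integral_boundedContinuousFunction b).comp continuous_conv)

section LocallyCompact

variable [T2Space K] [LocallyCompactSpace K]

lemma lowerSemicontinuous_lintegral_conv {F : K → ℝ≥0∞} (hF : LowerSemicontinuous F) :
    LowerSemicontinuous fun q : K × K => ∫⁻ s, F s ∂(conv q.1 q.2 : Measure K) := by
  simp only [lintegral_eq_iSup_ccMinorants _ hF]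
  exact lowerSemicontinuous_iSup fun g =>
    (continuous_lintegral_conv g.2.1 g.2.2.1).lowerSemicontinuous

/-- The mass that `δ_x * δ_y` gives to an open set is lower semicontinuous in `(x, y)`. -/
lemma lowerSemicontinuous_conv_apply {U : Set K} (hU : IsOpen U) :
    LowerSemicontinuous fun q : K × K => (conv q.1 q.2 : Measure K) U := by
  simpa only [lintegral_indicator_one hU.measurableSet] using
    lowerSemicontinuous_lintegral_conv (F := U.indicator 1)
      (hU.lowerSemicontinuous_indicator zero_le_one)

/-- Open sets being a generating `π`-system, semicontinuity on them makes the convolution a Borel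
kernel. -/
lemma measurable_conv_comp {Z : Type*} [TopologicalSpace Z] [MeasurableSpace Z] [BorelSpace Z]
    {u : Z → K × K} (hu : Continuous u) :
    Measurable fun z => (conv (u z).1 (u z).2 : Measure K) := by
  refine Measurable.measure_of_isPiSystem_of_isProbabilityMeasure
    (BorelSpace.measurable_eq (α := K)) isPiSystem_isOpen fun U hU => ?_
  exact ((lowerSemicontinuous_conv_apply hU).comp hu).measurable

/-- Associativity of the convolution as an equality of measures; regularity extends it from
`C_c(K)` to open sets, and these generate the Borel sets. -/
lemma conv_assoc_measure (x y z : K) :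
    (conv x y : Measure K).bind (fun t => (conv t z : Measure K)) =
      (conv y z : Measure K).bind (fun t => (conv x t : Measure K)) := by
  have m1 : Measurable fun t => (conv t z : Measure K) :=
    measurable_conv_comp (u := fun t => (t, z)) (by fun_prop)
  have m2 : Measurable fun t => (conv x t : Measure K) :=
    measurable_conv_comp (u := fun t => (x, t)) (by fun_prop)
  have hprob : IsProbabilityMeasure
      ((conv x y : Measure K).bind (fun t => (conv t z : Measure K))) :=
    ⟨by rw [Measure.bind_apply .univ m1.aemeasurable]; simp⟩
  have key : ∀ U : Set K, IsOpen U →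
      (conv x y : Measure K).bind (fun t => (conv t z : Measure K)) U =
      (conv y z : Measure K).bind (fun t => (conv x t : Measure K)) U := by
    intro U hU
    have hlsc : LowerSemicontinuous (U.indicator (1 : K → ℝ≥0∞)) :=
      hU.lowerSemicontinuous_indicator zero_le_one
    rw [Measure.bind_apply hU.measurableSet m1.aemeasurable,
      Measure.bind_apply hU.measurableSet m2.aemeasurable]
    simp only [← lintegral_indicator_one hU.measurableSet, lintegral_eq_iSup_ccMinorants _ hlsc]
    rw [lintegral_iSup_of_directed_of_lowerSemicontinuous,
      lintegral_iSup_of_directed_of_lowerSemicontinuous]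
    · congr 1 with g
      exact lintegral_conv_conv_of_hasCompactSupport x y z g.2.1 g.2.2.1
    · exact fun g => ((continuous_lintegral_conv g.2.1 g.2.2.1).comp
        (Continuous.prodMk_right x)).lowerSemicontinuous
    · exact directed_map_ccMinorants _ (T := fun h t => ∫⁻ s, h s ∂(conv x t : Measure K))
        fun g h hgh t => lintegral_mono hgh
    · exact fun g => ((continuous_lintegral_conv g.2.1 g.2.2.1).comp
        (Continuous.prodMk_left z)).lowerSemicontinuous
    · exact directed_map_ccMinorants _ (T := fun h t => ∫⁻ s, h s ∂(conv t z : Measure K))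
        fun g h hgh t => lintegral_mono hgh
  exact ext_of_generate_finite _ (BorelSpace.measurable_eq (α := K)) isPiSystem_isOpen key
    (key univ isOpen_univ)

end LocallyCompact

/-! ### Supports of convolutions -/

lemma inv_mem_support_conv {x y z : K} (h : z ∈ (conv x y : Measure K).support) :
    inv z ∈ (conv (inv y) (inv x) : Measure K).support := by
  rw [← map_inv_conv, Measure.mem_support_iff_forall (inv z)]
  intro U hU
  obtain ⟨V, hVU, hV, hzV⟩ := mem_nhds_iff.1 hU
  refine lt_of_lt_of_le ?_ (measure_mono hVU)
  rw [Measure.map_apply continuous_inv.measurable hV.measurableSet]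
  exact (Measure.mem_support_iff_forall z).1 h _ ((hV.preimage continuous_inv).mem_nhds hzV)

lemma isOpen_support_conv_subset {U : Set K} (hU : IsOpen U) :
    IsOpen {q : K × K | (conv q.1 q.2 : Measure K).support ⊆ U} :=
  letI := TopologicalSpace.vietoris K
  hU.powerset_vietoris.preimage continuous_support_conv

lemma isCompact_setMul {A B : Set K} (hA : IsCompact A) (hB : IsCompact B) :
    IsCompact (setMul A B) := by
  refine isCompact_of_finite_subcover fun {ι} U hU hcov => ?_
  have hloc : ∀ q ∈ A ×ˢ B, ∃ t : Finset ι,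
      (conv q.1 q.2 : Measure K).support ⊆ ⋃ i ∈ t, U i := by
    intro q hq
    refine (isCompact_support_conv q.1 q.2).elim_finite_subcover U hU
      (Subset.trans ?_ hcov)
    exact subset_biUnion_of_mem (u := fun x => ⋃ y ∈ B, (conv x y : Measure K).support) hq.1
      |>.trans' (subset_biUnion_of_mem (u := fun y => (conv q.1 y : Measure K).support) hq.2)
  obtain ⟨T, hT⟩ := (hA.prod hB).elim_directed_cover
    (fun t : Finset ι => {q : K × K | (conv q.1 q.2 : Measure K).support ⊆ ⋃ i ∈ t, U i})
    (fun t => isOpen_support_conv_subset (isOpen_biUnion fun i _ => hU i))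
    (fun q hq => mem_iUnion.2 (hloc q hq))
    (by
      classical
      refine directed_of_isDirected_le fun s t hst q hq => ?_
      exact Subset.trans hq (biUnion_subset_biUnion_left hst))
  refine ⟨T, iUnion₂_subset fun x hx => iUnion₂_subset fun y hy => ?_⟩
  exact hT (show (x, y) ∈ A ×ˢ B from ⟨hx, hy⟩)

lemma setPow_subset {S B : Set K} (he : (e : K) ∈ S) (hBS : B ⊆ S)
    (hS : ∀ y ∈ S, ∀ z ∈ S, (conv y z : Measure K).support ⊆ S) (n : ℕ) : setPow B n ⊆ S := by
  induction n with
  | zero => simpa [setPow] using he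
  | succ n ih => exact iUnion₂_subset fun y hy => iUnion₂_subset fun z hz => hS y (ih hy) z (hBS hz)

lemma inv_e [T2Space K] : inv (e : K) = e := by
  have h : (e : K) ∈ (conv (inv (e : K)) e : Measure K).support :=
    (e_mem_support_conv_iff (inv e) e).2 rfl
  have h1 : (conv (inv (e : K)) e : Measure K) {inv e}ᶜ = 0 := by
    rw [conv_e, Measure.dirac_apply' _ (measurableSet_singleton _).compl]; simp
  have h2 := Measure.support_subset_of_isClosed (isClosed_singleton (x := inv (e : K)))
    (mem_ae_iff.2 h1) h
  exact h2.symm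

lemma mem_setMul {A B : Set K} {z : K} :
    z ∈ setMul A B ↔ ∃ x ∈ A, ∃ y ∈ B, z ∈ (conv x y : Measure K).support := by
  simp [setMul]

section LocallyCompact

variable [T2Space K] [LocallyCompactSpace K]

/-- By semicontinuity the integral of `δ_{u₁ t} * δ_{u₂ t}` over `μ` charges every open set that
meets the support of one of these measures with `t ∈ supp μ`. -/
lemma bind_pos_of_mem {μ : Measure K} {u : K → K × K} (hu : Continuous u) {t s : K}
    (ht : t ∈ μ.support) (hs : s ∈ (conv (u t).1 (u t).2 : Measure K).support) {U : Set K}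
    (hU : IsOpen U) (hsU : s ∈ U) :
    0 < μ.bind (fun t => (conv (u t).1 (u t).2 : Measure K)) U := by
  rw [Measure.bind_apply hU.measurableSet (measurable_conv_comp hu).aemeasurable]
  have hlsc : LowerSemicontinuous fun t => (conv (u t).1 (u t).2 : Measure K) U :=
    (lowerSemicontinuous_conv_apply hU).comp hu
  rw [lintegral_pos_iff_support hlsc.measurable]
  have hopen : IsOpen {t | 0 < (conv (u t).1 (u t).2 : Measure K) U} := hlsc.isOpen_preimage 0
  have h0 := (Measure.mem_support_iff_forall _).1 hs U (hU.mem_nhds hsU)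
  refine ((Measure.mem_support_iff_forall _).1 ht _ (hopen.mem_nhds h0)).trans_le (measure_mono ?_)
  exact fun r hr => (show (0 : ℝ≥0∞) < _ from hr).ne'

lemma exists_mem_support_of_bind_pos {μ : Measure K} [μ.Regular] {u : K → K × K}
    (hu : Continuous u) {U : Set K} (hU : IsOpen U)
    (hpos : 0 < μ.bind (fun t => (conv (u t).1 (u t).2 : Measure K)) U) :
    ∃ t ∈ μ.support, ∃ s ∈ (conv (u t).1 (u t).2 : Measure K).support, s ∈ U := by
  by_contra! hcon
  refine hpos.ne' ?_
  rw [Measure.bind_apply hU.measurableSet (measurable_conv_comp hu).aemeasurable]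
  refine lintegral_eq_zero_of_ae_eq_zero ?_
  filter_upwards [Measure.support_mem_ae_of_regular (μ := μ)] with t ht
  refine measure_mono_null (fun s hs hs' => hcon t ht s hs' hs)
    (Measure.measure_compl_support_of_regular (μ := (conv (u t).1 (u t).2 : Measure K)))

/-- Associativity of the convolution, read off on supports. -/
lemma setMul_assoc_singleton (x y z : K) :
    setMul (conv x y : Measure K).support {z} = setMul {x} (conv y z : Measure K).support := by
  have u1 : Continuous fun t : K => (t, z) := by fun_prop
  have u2 : Continuous fun t : K => (x, t) := by fun_prop
  have c1 : IsClosed (setMul (conv x y : Measure K).support {z}) :=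
    (isCompact_setMul (isCompact_support_conv x y) isCompact_singleton).isClosed
  have c2 : IsClosed (setMul {x} (conv y z : Measure K).support) :=
    (isCompact_setMul isCompact_singleton (isCompact_support_conv y z)).isClosed
  refine Subset.antisymm (fun s hs => ?_) (fun s hs => ?_)
  · obtain ⟨t, ht, _, rfl, hs'⟩ := mem_setMul.1 hs
    by_contra hcon
    have := bind_pos_of_mem u1 ht hs' c2.isOpen_compl hcon
    simp only [conv_assoc_measure] at this
    obtain ⟨r, hr, w, hw, hw'⟩ := exists_mem_support_of_bind_pos u2 c2.isOpen_compl this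
    exact hw' (mem_setMul.2 ⟨x, rfl, r, hr, hw⟩)
  · obtain ⟨_, rfl, t, ht, hs'⟩ := mem_setMul.1 hs
    by_contra hcon
    have := bind_pos_of_mem u2 ht hs' c1.isOpen_compl hcon
    simp only [← conv_assoc_measure] at this
    obtain ⟨r, hr, w, hw, hw'⟩ := exists_mem_support_of_bind_pos u1 c1.isOpen_compl this
    exact hw' (mem_setMul.2 ⟨r, hr, z, rfl, hw⟩)

/-- `z ∈ x * y` implies `x ∈ z * y̌`: the first condition says `e ∈ (x * y) * ž`, the second
`e ∈ x * (y * ž)`. -/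
lemma mem_support_conv_inv_right {x y z : K} (h : z ∈ (conv x y : Measure K).support) :
    x ∈ (conv z (inv y) : Measure K).support := by
  have h1 : (e : K) ∈ setMul (conv x y : Measure K).support {inv z} :=
    mem_setMul.2 ⟨z, h, _, rfl, (e_mem_support_conv_iff _ _).2 (inv_inv z).symm⟩
  rw [setMul_assoc_singleton] at h1
  obtain ⟨_, rfl, t, ht, hs⟩ := mem_setMul.1 h1
  rw [e_mem_support_conv_iff] at hs
  subst hs
  have := inv_mem_support_conv ht
  simpa [inv_inv] using this

lemma mem_support_conv_inv_left {x y z : K} (h : z ∈ (conv x y : Measure K).support) :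
    y ∈ (conv (inv x) z : Measure K).support := by
  simpa only [inv_inv] using
    inv_mem_support_conv (mem_support_conv_inv_right (inv_mem_support_conv h))

end LocallyCompact
end Hypergroup

/-! ### Invariance of the Haar measure -/

namespace Hypergroup

variable {K : Type*} [TopologicalSpace K] [MeasurableSpace K] [BorelSpace K] [Hypergroup K]
  [T2Space K] [LocallyCompactSpace K]

lemma IsLeftHaar.lintegral_lintegral_conv_of_hasCompactSupport {ω : Measure K} (hω : IsLeftHaar ω)
    (x : K) {g : K → ℝ≥0} (hg : Continuous g) (hgc : HasCompactSupport g) :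
    ∫⁻ y, ∫⁻ s, (g s : ℝ≥0∞) ∂(conv x y : Measure K) ∂ω = ∫⁻ y, (g y : ℝ≥0∞) ∂ω := by
  have := hω.regular
  have hR : Continuous fun s => (g s : ℝ) := NNReal.continuous_coe.comp hg
  have hRc : HasCompactSupport fun s => (g s : ℝ) := hgc.comp_left (g := ((↑) : ℝ≥0 → ℝ)) rfl
  have hcont : Continuous fun y => ∫ s, (g s : ℝ) ∂(conv x y : Measure K) := by
    have h := (continuous_lintegral_conv hg hgc).comp (Continuous.prodMk_right x)
    have h' : ∀ y, ∫ s, (g s : ℝ) ∂(conv x y : Measure K) =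
        (∫⁻ s, (g s : ℝ≥0∞) ∂(conv x y : Measure K)).toReal := fun y => by
      rw [lintegral_coe_eq_ofReal_integral hg hgc,
        ENNReal.toReal_ofReal (integral_nonneg fun s => NNReal.coe_nonneg _)]
    simp only [h']
    refine ENNReal.continuousOn_toReal.comp_continuous h fun y => ?_
    simp only [lintegral_coe_eq_ofReal_integral hg hgc, mem_ofPred_eq]
    exact ENNReal.ofReal_ne_top
  -- the translate vanishes at `y` unless `x * y` meets the support of `g`, that is,
  -- unless `y ∈ x̌ * supp g`
  have hsupp : HasCompactSupport fun y => ∫ s, (g s : ℝ) ∂(conv x y : Measure K) := by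
    refine HasCompactSupport.intro (isCompact_setMul (isCompact_singleton (x := inv x))
      hgc.isCompact) fun y hy => ?_
    refine integral_eq_zero_of_ae ?_
    filter_upwards [Measure.support_mem_ae_of_regular (μ := (conv x y : Measure K))] with s hs
    by_contra hne
    refine hy (mem_setMul.2 ⟨_, rfl, s, ?_, mem_support_conv_inv_left hs⟩)
    by_contra hs'
    exact hne (by simp [image_eq_zero_of_notMem_tsupport hs'])
  simp only [lintegral_coe_eq_ofReal_integral hg hgc]
  rw [← ofReal_integral_eq_lintegral_ofReal (hcont.integrable_of_hasCompactSupport hsupp)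
    (Eventually.of_forall fun y => integral_nonneg fun s => NNReal.coe_nonneg _)]
  congr 1
  exact hω.left_invariant x _ hR hRc

/-- Left invariance for open sets, by `τ`-smoothness of `ω`. -/
lemma IsLeftHaar.lintegral_conv_apply_of_isOpen {ω : Measure K} (hω : IsLeftHaar ω)
    (x : K) {U : Set K} (hU : IsOpen U) :
    ∫⁻ y, (conv x y : Measure K) U ∂ω = ω U := by
  have := hω.regular
  have hlsc : LowerSemicontinuous (U.indicator (1 : K → ℝ≥0∞)) :=
    hU.lowerSemicontinuous_indicator zero_le_one
  simp only [← lintegral_indicator_one hU.measurableSet, lintegral_eq_iSup_ccMinorants _ hlsc]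
  rw [lintegral_iSup_of_directed_of_lowerSemicontinuous]
  · congr 1 with g
    exact hω.lintegral_lintegral_conv_of_hasCompactSupport x g.2.1 g.2.2.1
  · exact fun g => ((continuous_lintegral_conv g.2.1 g.2.2.1).comp
      (Continuous.prodMk_right x)).lowerSemicontinuous
  · exact directed_map_ccMinorants _ (T := fun h t => ∫⁻ s, h s ∂(conv x t : Measure K))
      fun g h hgh t => lintegral_mono hgh

/-- The measure `τ̌ * δ_x`, against which `τ * f` is integrated:
`(τ * f)(x) = ∫ f d(τ̌ * δ_x)`. -/
noncomputable def leftConv (τ : Measure K) (x : K) : Measure K :=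
  τ.bind fun y => (conv (inv y) x : Measure K)

lemma measurable_conv_inv (x : K) : Measurable fun y => (conv (inv y) x : Measure K) :=
  measurable_conv_comp (u := fun y => (inv y, x)) (continuous_inv.prodMk continuous_const)

lemma leftConv_apply (τ : Measure K) (x : K) {B : Set K} (hB : MeasurableSet B) :
    leftConv τ x B = ∫⁻ y, (conv (inv y) x : Measure K) B ∂τ :=
  Measure.bind_apply hB (measurable_conv_inv x).aemeasurable

instance (τ : Measure K) [IsProbabilityMeasure τ] (x : K) :
    IsProbabilityMeasure (leftConv τ x) :=
  ⟨by rw [leftConv_apply _ _ .univ]; simp⟩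

lemma lowerSemicontinuous_conv_inv_apply {U : Set K} (hU : IsOpen U) :
    LowerSemicontinuous fun q : K × K => (conv (inv q.2) q.1 : Measure K) U :=
  (lowerSemicontinuous_conv_apply hU).comp
    (g := fun q : K × K => (inv q.2, q.1))
    ((continuous_inv.comp continuous_snd).prodMk continuous_fst)

lemma measurable_leftConv (τ : Measure K) [IsProbabilityMeasure τ] [τ.Regular] :
    Measurable (leftConv τ) := by
  refine Measurable.measure_of_isPiSystem_of_isProbabilityMeasure
    (BorelSpace.measurable_eq (α := K)) isPiSystem_isOpen fun U hU => ?_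
  simp only [leftConv_apply _ _ (IsOpen.measurableSet hU)]
  exact (lowerSemicontinuous_lintegral_prodMk τ (lowerSemicontinuous_conv_inv_apply hU)).measurable

/-- The measure `τ̌ * ω` is at most `ω`, on all Borel sets. -/
lemma IsLeftHaar.bind_leftConv_le {ω : Measure K} (hω : IsLeftHaar ω) (τ : Measure K)
    [IsProbabilityMeasure τ] [τ.Regular] : ω.bind (leftConv τ) ≤ ω := by
  have := hω.regular
  refine bind_le_of_forall_isOpen (measurable_leftConv τ) fun U hU => ?_
  simp only [leftConv_apply _ _ hU.measurableSet]
  rw [lintegral_lintegral_swap_of_lowerSemicontinuous ω τ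
    (lowerSemicontinuous_conv_inv_apply hU)]
  simp [hω.lintegral_conv_apply_of_isOpen _ hU]

lemma measurable_conv_right (x : K) : Measurable fun y => (conv x y : Measure K) :=
  measurable_conv_comp (u := fun y => (x, y)) (Continuous.prodMk_right x)

lemma IsLeftHaar.bind_conv_le {ω : Measure K} (hω : IsLeftHaar ω) (x : K) :
    ω.bind (fun y => (conv x y : Measure K)) ≤ ω := by
  have := hω.regular
  exact bind_le_of_forall_isOpen (measurable_conv_right x) fun U hU =>
    (hω.lintegral_conv_apply_of_isOpen x hU).le

lemma IsLeftHaar.ae_conv_apply_eq_zero {ω : Measure K} (hω : IsLeftHaar ω) (x : K) {N : Set K}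
    (hN : ω N = 0) : ∀ᵐ y ∂ω, (conv x y : Measure K) N = 0 :=
  Measure.ae_ae_of_ae_bind (p := fun z => z ∉ N) (measurable_conv_right x).aemeasurable
    (Measure.absolutelyContinuous_of_le (hω.bind_conv_le x) |>.ae_le
      (measure_eq_zero_iff_ae_notMem.1 hN)) |>.mono fun _ hy => measure_eq_zero_iff_ae_notMem.2 hy

/-- `A` is invariant under `y` if, for `ω`-almost every `x ∈ A`, the measure `δ_y̌ * δ_x` is
concentrated on `A`. -/
def invariantSet (ω : Measure K) (A : Set K) : Set K :=
  {y | ∫⁻ x in A, (conv (inv y) x : Measure K) Aᶜ ∂ω = 0}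

lemma mem_invariantSet_iff {ω : Measure K} {A : Set K} (hA : MeasurableSet A) {y : K} :
    y ∈ invariantSet ω A ↔ ∀ᵐ x ∂ω, x ∈ A → (conv (inv y) x : Measure K) Aᶜ = 0 := by
  rw [invariantSet, mem_ofPred_eq, lintegral_eq_zero_iff, ← ae_restrict_iff' hA]
  · rfl
  · exact Measure.measurable_coe hA.compl |>.comp (measurable_conv_right _)

lemma lowerSemicontinuous_indicator_conv_inv_apply {U V : Set K} (hU : IsOpen U) (hV : IsOpen V) :
    LowerSemicontinuous fun q : K × K =>
      U.indicator (fun x => (conv (inv q.2) x : Measure K) V) q.1 := by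
  intro q c hc
  by_cases hq : q.1 ∈ U
  · simp only [indicator_of_mem hq] at hc
    filter_upwards [lowerSemicontinuous_conv_inv_apply hV q c hc,
      continuous_fst.continuousAt.preimage_mem_nhds (hU.mem_nhds hq)] with r hr hrU
    rwa [indicator_of_mem (show r.1 ∈ U from hrU)]
  · simp [indicator_of_notMem hq] at hc

lemma lowerSemicontinuous_setLIntegral_conv_inv_apply (ω : Measure K) [ω.Regular] {U V : Set K}
    (hU : IsOpen U) (hV : IsOpen V) :
    LowerSemicontinuous fun y => ∫⁻ x in U, (conv (inv y) x : Measure K) V ∂ω := by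
  simp only [← lintegral_indicator hU.measurableSet]
  exact lowerSemicontinuous_lintegral_prodMk ω
    ((lowerSemicontinuous_indicator_conv_inv_apply hU hV).comp continuous_swap)

lemma setLIntegral_leftConv_apply_swap (ω τ : Measure K) [ω.Regular] [τ.Regular] {U V : Set K}
    (hU : IsOpen U) (hV : IsOpen V) :
    ∫⁻ x in U, leftConv τ x V ∂ω =
      ∫⁻ y, ∫⁻ x in U, (conv (inv y) x : Measure K) V ∂ω ∂τ := by
  have := lintegral_lintegral_swap_of_lowerSemicontinuous ω τ
    (lowerSemicontinuous_indicator_conv_inv_apply hU hV)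
  simp only [lintegral_indicator hU.measurableSet] at this
  rw [← this, ← lintegral_indicator hU.measurableSet]
  congr 1 with x
  by_cases hx : x ∈ U
  · simp [hx, leftConv_apply _ _ hV.measurableSet]
  · simp [hx]

/-- The mass that leaves `A` under `y̌` is lower semicontinuous in `y`: up to a uniformly small
error it is the mass that goes from an open `U ⊇ A` to the complement of a compact `C ⊆ A`, and the
latter is lower semicontinuous. -/
lemma lowerSemicontinuous_escape {ω : Measure K} (hω : IsLeftHaar ω) {A : Set K}
    (hA : MeasurableSet A) (hωA : ω A ≠ ∞) :
    LowerSemicontinuous fun y => ∫⁻ x in A, (conv (inv y) x : Measure K) Aᶜ ∂ω := by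
  have := hω.regular
  intro y c hc
  obtain ⟨C, U, hCA, hAU, hC, hU, hlt⟩ := exists_isCompact_isOpen_sdiff_lt (ω := ω) hA hωA
    (tsub_pos_of_lt hc).ne'
  have hy : c + (ω (A \ C) + ω (U \ A)) < ∫⁻ x in U, (conv (inv y) x : Measure K) Cᶜ ∂ω := by
    refine lt_of_lt_of_le (lt_tsub_iff_left.1 hlt) ?_
    exact (lintegral_mono fun x => measure_mono (compl_subset_compl.2 hCA)).trans
      (lintegral_mono_set hAU)
  filter_upwards [lowerSemicontinuous_setLIntegral_conv_inv_apply ω hU hC.isClosed.isOpen_compl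
    y _ hy] with z hz
  have hle := lintegral_restrict_compl_le (measurable_conv_right (inv z)) (hω.bind_conv_le (inv z))
    hC.measurableSet hA hAU
  rw [add_assoc] at hle
  exact lt_of_add_lt_add_right (hz.trans_le hle)

lemma isClosed_invariantSet {ω : Measure K} (hω : IsLeftHaar ω) {A : Set K}
    (hA : MeasurableSet A) (hωA : ω A ≠ ∞) : IsClosed (invariantSet ω A) := by
  have h := (lowerSemicontinuous_escape hω hA hωA).isClosed_preimage 0
  convert h using 1
  ext y
  simp [invariantSet]

/-- If almost no point of `A` escapes under `τ`, the same is true for each single point of the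
support of `τ`. -/
lemma support_subset_invariantSet {ω : Measure K} (hω : IsLeftHaar ω) {A : Set K}
    (hA : MeasurableSet A) (hωA : ω A ≠ ∞) (τ : Measure K) [IsProbabilityMeasure τ] [τ.Regular]
    (h : ∀ᵐ x ∂ω, x ∈ A → leftConv τ x Aᶜ = 0) : τ.support ⊆ invariantSet ω A := by
  have := hω.regular
  have hzero : ∫⁻ x in A, leftConv τ x Aᶜ ∂ω = 0 := by
    rw [setLIntegral_congr_fun_ae hA h]; simp
  have hint : ∫⁻ y, ∫⁻ x in A, (conv (inv y) x : Measure K) Aᶜ ∂ω ∂τ = 0 := by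
    by_contra hne
    obtain ⟨C, U, hCA, hAU, hC, hU, hlt⟩ := exists_isCompact_isOpen_sdiff_lt (ω := ω) hA hωA hne
    refine hlt.not_ge ?_
    calc _ ≤ ∫⁻ y, ∫⁻ x in U, (conv (inv y) x : Measure K) Cᶜ ∂ω ∂τ :=
          lintegral_mono fun y => (lintegral_mono fun x => measure_mono
            (compl_subset_compl.2 hCA)).trans (lintegral_mono_set hAU)
      _ = ∫⁻ x in U, leftConv τ x Cᶜ ∂ω :=
        (setLIntegral_leftConv_apply_swap ω τ hU hC.isClosed.isOpen_compl).symm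
      _ ≤ _ := lintegral_restrict_compl_le (measurable_leftConv τ) (hω.bind_leftConv_le τ)
        hC.measurableSet hA hAU
      _ = _ := by rw [hzero, zero_add]
  rw [lintegral_eq_zero_iff (lowerSemicontinuous_escape hω hA hωA).measurable] at hint
  exact Measure.support_subset_of_isClosed (isClosed_invariantSet hω hA hωA) hint

lemma e_mem_invariantSet (ω : Measure K) {A : Set K} (hA : MeasurableSet A) :
    (e : K) ∈ invariantSet ω A := by
  rw [mem_invariantSet_iff hA]
  refine Eventually.of_forall fun x hx => ?_
  rw [inv_e, e_conv, Measure.dirac_apply' _ hA.compl]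
  simp [hx]

/-- Associativity and the involution: `(δ_y * δ_z)ˇ * δ_x = δ_ž * (δ_y̌ * δ_x)`. -/
lemma leftConv_conv (x y z : K) :
    leftConv (conv y z : Measure K) x =
      (conv (inv y) x : Measure K).bind fun t => (conv (inv z) t : Measure K) := by
  rw [← conv_assoc_measure, ← map_inv_conv]
  refine Measure.ext fun B hB => ?_
  have hm : Measurable fun t => (conv t x : Measure K) :=
    measurable_conv_comp (u := fun t => (t, x)) (Continuous.prodMk_left x)
  rw [leftConv_apply _ _ hB, Measure.bind_apply hB hm.aemeasurable,
    lintegral_map (f := fun t => (conv t x : Measure K) B)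
      ((Measure.measurable_coe hB).comp hm) continuous_inv.measurable]

/-- If `A` is invariant under `y` and `z`, it is invariant under every point of `supp (δ_y * δ_z)`:
`δ_y̌ * δ_x` ignores the null set of points of `A` which `ž` moves off `A`. -/
lemma support_conv_subset_invariantSet {ω : Measure K} (hω : IsLeftHaar ω) {A : Set K}
    (hA : MeasurableSet A) (hωA : ω A ≠ ∞) {y z : K} (hy : y ∈ invariantSet ω A)
    (hz : z ∈ invariantSet ω A) : (conv y z : Measure K).support ⊆ invariantSet ω A := by
  refine support_subset_invariantSet hω hA hωA _ ?_
  rw [mem_invariantSet_iff hA] at hy hz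
  filter_upwards [hy, hω.ae_conv_apply_eq_zero (inv y) (ae_iff.1 hz)] with x hx hx' hxA
  rw [leftConv_conv, Measure.bind_apply hA.compl (measurable_conv_right _).aemeasurable]
  refine lintegral_eq_zero_of_ae_eq_zero ?_
  filter_upwards [measure_eq_zero_iff_ae_notMem.1 (hx hxA),
    measure_eq_zero_iff_ae_notMem.1 hx'] with t ht ht'
  simp only [mem_compl_iff, not_not, Classical.not_imp, not_and] at ht ht'
  exact ht' ht

/-- In a non-compact hypergroup a set of finite positive measure is not invariant under all of `K`:
if `C ⊆ A` is compact and `y̌ ∉ C * Č`, then `y̌ * x` misses `C` for all `x ∈ C`, so that `y̌` moves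
most of `A` off `A`. -/
lemma measure_eq_zero_of_invariantSet_eq_univ [NoncompactSpace K] {ω : Measure K}
    (hω : IsLeftHaar ω) {A : Set K} (hA : MeasurableSet A) (hωA : ω A ≠ ∞)
    (h : invariantSet ω A = univ) : ω A = 0 := by
  have := hω.regular
  by_contra hne
  obtain ⟨C, hCA, hC, hC'⟩ := hA.exists_isCompact_sdiff_lt hωA (ENNReal.half_pos hne).ne'
  obtain ⟨w, hw⟩ := (ne_univ_iff_exists_notMem _).1
    (isCompact_setMul hC (hC.image continuous_inv)).ne_univ
  have hmiss : ∀ x ∈ C, (conv w x : Measure K) C = 0 := by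
    intro x hx
    refine measure_mono_null (fun z hz (hz' : z ∈ (conv w x : Measure K).support) => hw ?_)
      (Measure.measure_compl_support_of_regular (μ := (conv w x : Measure K)))
    exact mem_setMul.2 ⟨z, hz, _, mem_image_of_mem inv hx, mem_support_conv_inv_right hz'⟩
  have hinv : inv w ∈ invariantSet ω A := h ▸ mem_univ _
  rw [mem_invariantSet_iff hA, inv_inv] at hinv
  have hCle : ω C ≤ ω (A \ C) := by
    calc ω C = ∫⁻ x in C, 1 ∂ω := by simp
      _ ≤ ∫⁻ x in C, (conv w x : Measure K) (A \ C) ∂ω := by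
        refine setLIntegral_mono_ae' hC.measurableSet ?_
        filter_upwards [hinv] with x hx hxC
        calc (1 : ℝ≥0∞) = (conv w x : Measure K) univ := by simp
          _ ≤ (conv w x : Measure K) ((Aᶜ ∪ C) ∪ A \ C) := by
            refine measure_mono fun z _ => ?_
            by_cases hzA : z ∈ A <;> by_cases hzC : z ∈ C <;> simp [hzA, hzC]
          _ ≤ (conv w x : Measure K) Aᶜ + (conv w x : Measure K) C
              + (conv w x : Measure K) (A \ C) :=
            (measure_union_le _ _).trans (by gcongr; exact measure_union_le _ _)
          _ = _ := by rw [hx (hCA hxC), hmiss x hxC]; simp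
      _ ≤ ∫⁻ x, (conv w x : Measure K) (A \ C) ∂ω := setLIntegral_le_lintegral _ _
      _ ≤ ω (A \ C) := by
        rw [← Measure.bind_apply (hA.diff hC.measurableSet) (measurable_conv_right w).aemeasurable]
        exact hω.bind_conv_le w _
  have : ω A < ω A := by
    calc ω A ≤ ω C + ω (A \ C) := by
          rw [← measure_union_add_inter C (hA.diff hC.measurableSet)]
          exact (measure_mono (by simp)).trans le_self_add
      _ ≤ ω (A \ C) + ω (A \ C) := by gcongr
      _ < ω A / 2 + ω A / 2 := ENNReal.add_lt_add hC' hC'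
      _ = ω A := ENNReal.add_halves _
  exact this.false

/-- A set of finite measure from which almost no point escapes under `σ` is null. -/
lemma measure_eq_zero_of_ae_leftConv_compl_eq_zero [NoncompactSpace K] {ω : Measure K}
    (hω : IsLeftHaar ω) (σ : Measure K) [IsProbabilityMeasure σ] [σ.Regular]
    (hσ : NonDegenerate σ) {A : Set K} (hA : MeasurableSet A) (hωA : ω A ≠ ∞)
    (h : ∀ᵐ x ∂ω, x ∈ A → leftConv σ x Aᶜ = 0) : ω A = 0 := by
  refine measure_eq_zero_of_invariantSet_eq_univ hω hA hωA (univ_subset_iff.1 ?_)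
  rw [← hσ]
  refine closure_minimal (iUnion₂_subset fun n _ => ?_) (isClosed_invariantSet hω hA hωA)
  exact setPow_subset (e_mem_invariantSet ω hA) (support_subset_invariantSet hω hA hωA σ h)
    (fun y hy z hz => support_conv_subset_invariantSet hω hA hωA hy hz) n

end Hypergroup

/-! ### Harmonic functions -/

/-- The equality case of Jensen's inequality for `t ↦ t ^ p`. -/
lemma ae_eq_const_of_integral_rpow_le {X : Type*} [MeasurableSpace X] {μ : Measure X}
    [IsProbabilityMeasure μ] {u : X → ℝ} {p a : ℝ} (hp : 1 < p) (ha : 0 ≤ a) (hu : ∀ x, 0 ≤ u x)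
    (hui : Integrable u μ) (hupi : Integrable (fun x => u x ^ p) μ) (h1 : a ≤ ∫ x, u x ∂μ)
    (h2 : ∫ x, u x ^ p ∂μ ≤ a ^ p) : ∀ᵐ x ∂μ, u x = a := by
  have hp0 : 0 < p := by linarith
  rcases (strictConvexOn_rpow hp).ae_eq_const_or_map_average_lt
    (continuousOn_id.rpow_const fun x _ => Or.inr hp0.le) isClosed_Ici
    (Eventually.of_forall hu) hui hupi with h | h
  · rw [average_eq_integral] at h
    have hc : 0 ≤ ∫ x, u x ∂μ := integral_nonneg hu
    have h3 : ∫ x, u x ^ p ∂μ = (∫ x, u x ∂μ) ^ p := by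
      rw [integral_congr_ae (h.mono fun x hx => by rw [hx])]
      simp
    rw [h3, Real.rpow_le_rpow_iff hc ha hp0] at h2
    filter_upwards [h] with x hx
    rw [hx]
    exact le_antisymm h2 h1
  · simp only [average_eq_integral] at h
    exact absurd (h.trans_le h2) (Real.rpow_le_rpow ha h1 hp0.le).not_gt

namespace Hypergroup

variable {K : Type*} [TopologicalSpace K] [MeasurableSpace K] [BorelSpace K] [Hypergroup K]
  [T2Space K] [LocallyCompactSpace K]

/-- This needs no integrability of `f`: where an integral takes its junk value `0`, the bound is
trivial. -/
lemma enorm_measureConv_le (σ : Measure K) {f : K → ℂ} (hf : Measurable f) (x : K) :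
    ‖measureConv σ f x‖ₑ ≤ ∫⁻ t, ‖f t‖ₑ ∂(leftConv σ x) := by
  rw [leftConv, Measure.lintegral_bind (measurable_conv_inv x).aemeasurable
    hf.enorm.aemeasurable]
  exact (enorm_integral_le_lintegral_enorm _).trans
    (lintegral_mono fun y => enorm_integral_le_lintegral_enorm _)

/-- If `σ * f = f` with `f ∈ L^p`, `1 < p < ∞`, then for almost every `x` the modulus of `f` is
`σ̌ * δ_x`-almost everywhere equal to its value at `x`: the two sides of
`|f x| ^ p ≤ ∫ |f| ^ p d(σ̌ * δ_x)` have comparable integrals, so there is equality in Jensen's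
inequality almost everywhere. -/
lemma ae_ae_norm_eq_of_measureConv_ae_eq {ω : Measure K} (hω : IsLeftHaar ω) (σ : Measure K)
    [IsProbabilityMeasure σ] [σ.Regular] {p : ℝ≥0∞} (hp₁ : 1 < p) (hp : p < ∞) {f : K → ℂ}
    (hf : Measurable f) (hfp : MemLp f p ω) (h : measureConv σ f =ᵐ[ω] f) :
    ∀ᵐ x ∂ω, ∀ᵐ t ∂(leftConv σ x), ‖f t‖ = ‖f x‖ := by
  have hp0 : p ≠ 0 := (zero_lt_one.trans hp₁).ne'
  have hr : 1 < p.toReal := by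
    rw [← ENNReal.toReal_one]; exact (ENNReal.toReal_lt_toReal ENNReal.one_ne_top hp.ne).2 hp₁
  have hr0 : 0 < p.toReal := by linarith
  have hP := measurable_leftConv σ
  set F : K → ℝ≥0∞ := fun x => ‖f x‖ₑ ^ p.toReal with hF
  have hFm : Measurable F := hf.enorm.pow_const _
  have hFint : ∫⁻ x, F x ∂ω ≠ ∞ :=
    (lintegral_rpow_enorm_lt_top_of_eLpNorm_lt_top hp0 hp.ne hfp.eLpNorm_lt_top).ne
  have hbind : ∫⁻ x, ∫⁻ t, F t ∂(leftConv σ x) ∂ω ≤ ∫⁻ x, F x ∂ω := by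
    rw [← Measure.lintegral_bind hP.aemeasurable hFm.aemeasurable]
    exact lintegral_mono' (hω.bind_leftConv_le σ) le_rfl
  have hm : Measurable fun x => ∫⁻ t, F t ∂(leftConv σ x) :=
    (Measure.measurable_lintegral hFm).comp hP
  have hle1 : ∀ᵐ x ∂ω, ‖f x‖ₑ ≤ ∫⁻ t, ‖f t‖ₑ ∂(leftConv σ x) := by
    filter_upwards [h] with x hx
    rw [← hx]
    exact enorm_measureConv_le σ hf x
  have hle : F ≤ᵐ[ω] fun x => ∫⁻ t, F t ∂(leftConv σ x) := by
    filter_upwards [hle1] with x hx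
    have h1 := eLpNorm_le_eLpNorm_of_exponent_le (μ := leftConv σ x) hp₁.le
      hf.aestronglyMeasurable
    rw [eLpNorm_one_eq_lintegral_enorm, eLpNorm_eq_lintegral_rpow_enorm_toReal hp0 hp.ne] at h1
    rw [one_div] at h1
    exact (ENNReal.le_rpow_inv_iff hr0).1 (hx.trans h1)
  have heq := ae_eq_of_ae_le_of_lintegral_le hle hFint hm.aemeasurable hbind
  filter_upwards [heq, hle1, ae_lt_top hFm hFint] with x hx hx1 hxt
  have hmem : MemLp f p (leftConv σ x) := by
    refine ⟨hf.aestronglyMeasurable, ?_⟩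
    rw [eLpNorm_lt_top_iff_lintegral_rpow_enorm_lt_top hp0 hp.ne]
    exact hx ▸ hxt
  have hfi : Integrable f (leftConv σ x) := hmem.integrable hp₁.le
  have hfpi : Integrable (fun t => ‖f t‖ ^ p.toReal) (leftConv σ x) :=
    hmem.integrable_norm_rpow hp0 hp.ne
  refine ae_eq_const_of_integral_rpow_le hr (norm_nonneg _) (fun t => norm_nonneg _) hfi.norm hfpi
    ?_ ?_
  · rw [← ENNReal.ofReal_le_ofReal_iff (integral_nonneg fun t => norm_nonneg _),
      ofReal_integral_norm_eq_lintegral_enorm hfi, ofReal_norm]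
    exact hx1
  · rw [← ENNReal.ofReal_le_ofReal_iff (by positivity),
      ofReal_integral_eq_lintegral_ofReal hfpi (Eventually.of_forall fun t => by positivity)]
    simp only [← ENNReal.ofReal_rpow_of_nonneg (norm_nonneg _) hr0.le, ofReal_norm]
    exact hx.ge

lemma measureConv_ae_eq_zero {ω : Measure K} (hω : IsLeftHaar ω) (σ : Measure K)
    [IsProbabilityMeasure σ] [σ.Regular] {f : K → ℂ} (hf : Measurable f) (h : f =ᵐ[ω] 0) :
    measureConv σ f =ᵐ[ω] 0 := by
  have := Measure.ae_ae_of_ae_bind (measurable_leftConv σ).aemeasurable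
    ((Measure.absolutelyContinuous_of_le (hω.bind_leftConv_le σ)).ae_le h)
  filter_upwards [this] with x hx
  have h0 : ∫⁻ t, ‖f t‖ₑ ∂(leftConv σ x) = 0 :=
    (lintegral_eq_zero_iff hf.enorm).2 (hx.mono fun t ht => by simp [ht])
  simpa [h0] using enorm_measureConv_le σ hf x

end Hypergroup

theorem mainTheorem3 {K : Type*} [TopologicalSpace K] [T2Space K] [LocallyCompactSpace K]
    [MeasurableSpace K] [BorelSpace K] [Hypergroup K] [NoncompactSpace K]
    (ω : Measure K) (hω : Hypergroup.IsLeftHaar ω)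
    (σ : Measure K) [IsProbabilityMeasure σ] [σ.Regular] (hσ : Hypergroup.NonDegenerate σ)
    (p : ℝ≥0∞) (hp₁ : 1 < p) (hp : p < ∞) :
    Hypergroup.harmonicLp σ ω p = {0} := by
  refine Subset.antisymm (fun f hf => ?_) (singleton_subset_iff.2 ?_)
  · have hfm : Measurable f := (Lp.stronglyMeasurable f).measurable
    have hfp : MemLp f p ω := Lp.memLp f
    have hconst := Hypergroup.ae_ae_norm_eq_of_measureConv_ae_eq hω σ hp₁ hp hfm hfp hf
    have hlevel : ∀ n : ℕ, ω {x | (1 : ℝ) / (n + 1) < ‖f x‖} = 0 := by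
      intro n
      have hn : (0 : ℝ) < 1 / (n + 1) := by positivity
      refine Hypergroup.measure_eq_zero_of_ae_leftConv_compl_eq_zero hω σ hσ
        (measurableSet_lt measurable_const hfm.norm) ?_ ?_
      · have := hfp.meas_ge_lt_top (zero_lt_one.trans hp₁).ne' hp.ne
          (ε := ⟨1 / (n + 1), hn.le⟩) (fun h0 => hn.ne' (congrArg NNReal.toReal h0))
        refine ((measure_mono ?_).trans_lt this).ne
        exact fun x (hx : (1 : ℝ) / (n + 1) < ‖f x‖) => NNReal.coe_le_coe.1 hx.le
      · filter_upwards [hconst] with x hx hxA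
        refine measure_eq_zero_iff_ae_notMem.2 (hx.mono fun t ht hmem => hmem ?_)
        rwa [mem_ofPred_eq, ht]
    have hall : ∀ᵐ x ∂ω, ∀ n : ℕ, ¬ (1 : ℝ) / (n + 1) < ‖f x‖ :=
      ae_all_iff.2 fun n => measure_eq_zero_iff_ae_notMem.1 (hlevel n)
    refine mem_singleton_iff.2 ((Lp.eq_zero_iff_ae_eq_zero).2 ?_)
    filter_upwards [hall] with x hx
    by_contra hne
    obtain ⟨n, hn⟩ := exists_nat_one_div_lt (norm_pos_iff.2 hne)
    exact hx n hn
  · have h0 : ((0 : Lp ℂ p ω) : K → ℂ) =ᵐ[ω] 0 := Lp.coeFn_zero ℂ p ω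
    exact (Hypergroup.measureConv_ae_eq_zero hω σ
      (Lp.stronglyMeasurable (0 : Lp ℂ p ω)).measurable h0).trans h0.symm
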